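/- Fix a set $P$ of propositional variables and a set $\mathcal A$ of agents. An interpretation is a subset of $P$. All ordinals below are countable. By simultaneous transfinite recursion one defines, for each ordinal $\mu$, the $\mu$-prebiworlds and their restrictions. A $0$-prebiworld $w$ is an interpretation, and $\mathrm{obj}(w)=w$. A $(\mu+1)$-prebiworld $w$ is a triple $(I,(A^w)_{A\in\mathcal A},(\bar A^w)_{A\in\mathcal A})$ with $I=\mathrm{obj}(w)$ an interpretation and each $A^w$, $\bar A^w$ a set of $\mu$-prebiworlds. For a limit ordinal $\lambda$, a $\lambda$-prebiworld is a sequence $w=(w_\alpha)_{\alpha<\lambda}$, where each $w_\alpha$ is an $\alpha$-prebiworld and $w_\beta\le_p w_\alpha$ for all $\beta\le\alpha<\lambda$; here $\mathrm{obj}(w)=w_0$. The restriction $w|_\alpha$ of a $\mu$-prebiworld $w$ to $\alpha\le\mu$ is: $\mathrm{obj}(w)$ if $\alpha=0$; the sequence $(w|_\beta)_{\beta<\alpha}$ if $\alpha$ is a limit; $w_\alpha$ if $\alpha$ is a successor and $\mu$ is a limit; and, if $\alpha=\alpha'+1$ and $\mu=\mu'+1$, the triple with interpretation $\mathrm{obj}(w)$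 and sets $\{v|_{\alpha'} : v\in A^w\}$ and $\{v|_{\alpha'} : v\in\bar A^w\}$ for $A\in\mathcal A$. For an $\alpha$-prebiworld $v$ and a $\mu$-prebiworld $w$ with $\alpha\le\mu$, $v\le_p w$ ($w$ extends $v$) means $w|_\alpha=v$. By transfinite recursion on depth one defines biworlds and incompleted prebiworlds. Every $0$-prebiworld is a $0$-biworld. For a limit $\lambda$, a $\lambda$-prebiworld $w$ is a $\lambda$-biworld iff every $w_\alpha$ ($\alpha<\lambda$) is an $\alpha$-biworld. Given the set of $\mu$-biworlds, the incompleted $\mu$-prebiworlds and the $(\mu+1)$-biworlds form the least pair of sets such that: a $\mu$-prebiworld $w$ is incompleted iff it has two distinct $(\mu+1)$-biworld extensions; and a $(\mu+1)$-prebiworld $w$ is a $(\mu+1)$-biworld iff for every agent $A$, $A^w\cup\bar A^w$ is the set of all $\mu$-biworlds and every element of $A^w\cap\bar A^w$ is incompleted. A prebiworld that is not incompleted is called completed. Claim. Let $\mu$ be a countable ordinal and $w$ a $\mu$-biworld. Then $w$ is completed if and only if there exists exactly one $(\mu+1)$-biworld $v$ with $v\ge_p w$. In this case, $v$ is also completed.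 -/

import Mathlib

universe u v

namespace EpistemicBiworld

/-- The carrier in which the prebiworlds of depth `μ` over the vocabulary `P` and the set of agents
`Ag` live; an interpretation over `P` is the set of the propositional variables that are true.
* depth `0`: interpretations;
* depth `μ + 1`: triples of an interpretation and, for each agent, two sets of elements of the
  carrier of depth `μ`;
* limit depth `l`: sequences indexed by the ordinals below `l`, with entry `β` of depth `β`.
The only requirement on prebiworlds that is not yet built in here is that the sequences at limit
depths are increasing for the precision order; it is imposed (hereditarily) by `IsPrebiworld`,
since the precision order is defined on top of the carrier. -/
noncomputable def Carrier (P : Type u) (Ag : Type v) (μ : Ordinal.{0}) : Type (max 1 u v) :=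
  Ordinal.limitRecOn (motive := fun _ => Type (max 1 u v)) μ
    (ULift.{max 1 v} (Set P))
    (fun _ T => Set P × (Ag → Set T) × (Ag → Set T))
    (fun l _ T => ∀ (β : Ordinal.{0}) (hβ : β < l), T β hβ)

/-- Elements of depth `0` are interpretations. -/
noncomputable def zeroEquiv (P : Type u) (Ag : Type v) : Carrier P Ag 0 ≃ Set P :=
  (Equiv.cast (Ordinal.limitRecOn_zero _ _ _)).trans Equiv.ulift

/-- Elements of depth `μ + 1` are triples. -/
noncomputable def succEquiv (P : Type u) (Ag : Type v) (μ : Ordinal.{0}) :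
    Carrier P Ag (μ + 1) ≃
      Set P × (Ag → Set (Carrier P Ag μ)) × (Ag → Set (Carrier P Ag μ)) :=
  Equiv.cast (Ordinal.limitRecOn_add_one _ _ _ _)

/-- Elements of limit depth are sequences. -/
noncomputable def limitEquiv (P : Type u) (Ag : Type v) {l : Ordinal.{0}}
    (hl : Order.IsSuccLimit l) :
    Carrier P Ag l ≃ ∀ β : Ordinal.{0}, β < l → Carrier P Ag β :=
  Equiv.cast (Ordinal.limitRecOn_limit _ _ _ _ hl)

/-- The set `A^w` (for `w` of successor depth). -/
noncomputable def poss {P : Type u} {Ag : Type v} {μ : Ordinal.{0}} (w : Carrier P Ag (μ + 1))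
    (A : Ag) : Set (Carrier P Ag μ) :=
  (succEquiv P Ag μ w).2.1 A

/-- The set `Ā^w` (for `w` of successor depth). -/
noncomputable def imposs {P : Type u} {Ag : Type v} {μ : Ordinal.{0}} (w : Carrier P Ag (μ + 1))
    (A : Ag) : Set (Carrier P Ag μ) :=
  (succEquiv P Ag μ w).2.2 A

/-- The entry `(w)_β` (for `w` of limit depth). -/
noncomputable def entry {P : Type u} {Ag : Type v} {l : Ordinal.{0}} (hl : Order.IsSuccLimit l)
    (w : Carrier P Ag l) (β : Ordinal.{0}) (hβ : β < l) : Carrier P Ag β :=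
  limitEquiv P Ag hl w β hβ

/-- The objective interpretation of `w`; at limit depth it is the entry at position `0`. -/
noncomputable def obj {P : Type u} {Ag : Type v} (μ : Ordinal.{0}) : Carrier P Ag μ → Set P :=
  Ordinal.limitRecOn (motive := fun μ => Carrier P Ag μ → Set P) μ
    (fun w => zeroEquiv P Ag w)
    (fun μ' _ w => (succEquiv P Ag μ' w).1)
    (fun _ hl _ w => zeroEquiv P Ag (entry hl w 0 hl.bot_lt))

/-- Restriction from depth `μ` to the depths `α ≤ μ`, by recursion on `α`, where `step` supplies the
restrictions from depth `μ` to successor depths. -/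
noncomputable def restrictOf {P : Type u} {Ag : Type v} (μ : Ordinal.{0})
    (step : ∀ α' : Ordinal.{0}, α' + 1 ≤ μ → Carrier P Ag μ → Carrier P Ag (α' + 1))
    (α : Ordinal.{0}) : α ≤ μ → Carrier P Ag μ → Carrier P Ag α :=
  Ordinal.limitRecOn (motive := fun α => α ≤ μ → Carrier P Ag μ → Carrier P Ag α) α
    (fun _ w => (zeroEquiv P Ag).symm (obj μ w))
    (fun α' _ h w => step α' h w)
    (fun _ hl ih h w => (limitEquiv P Ag hl).symm fun β hβ => ih β hβ (hβ.le.trans h) w)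

/-- Restriction from depth `μ` to the successor depths `α' + 1 ≤ μ`, by recursion on `μ`. -/
noncomputable def restrictSucc {P : Type u} {Ag : Type v} (μ : Ordinal.{0}) :
    ∀ α' : Ordinal.{0}, α' + 1 ≤ μ → Carrier P Ag μ → Carrier P Ag (α' + 1) :=
  Ordinal.limitRecOn
    (motive := fun μ => ∀ α' : Ordinal.{0}, α' + 1 ≤ μ → Carrier P Ag μ → Carrier P Ag (α' + 1)) μ
    (fun _ h => absurd (Order.add_one_le_iff.mp h) not_lt_bot)
    (fun μ' ih α' h w => (succEquiv P Ag α').symm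
      (obj (μ' + 1) w,
        fun A => restrictOf μ' ih α' (by simpa using h) '' poss w A,
        fun A => restrictOf μ' ih α' (by simpa using h) '' imposs w A))
    (fun _ hl _ α' h w =>
      entry hl w (α' + 1) (hl.add_one_lt (Order.add_one_le_iff.mp h)))

/-- The restriction `w|_α` of an element `w` of depth `μ` to depth `α ≤ μ`. -/
noncomputable def restrict {P : Type u} {Ag : Type v} {μ : Ordinal.{0}} (w : Carrier P Ag μ)
    (α : Ordinal.{0}) (h : α ≤ μ) : Carrier P Ag α :=
  restrictOf μ (restrictSucc μ) α h w

/-- The precision order: `v ≤ₚ w` if the restriction of `w` to the depth of `v` is `v`. -/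
def LessPrecise {P : Type u} {Ag : Type v} {α μ : Ordinal.{0}} (v : Carrier P Ag α)
    (w : Carrier P Ag μ) : Prop :=
  ∃ h : α ≤ μ, restrict w α h = v

/-- The prebiworlds of depth `μ`: hereditarily, the sequences at limit depths are increasing for the
precision order. -/
def IsPrebiworld {P : Type u} {Ag : Type v} {μ : Ordinal.{0}} : Carrier P Ag μ → Prop :=
  Ordinal.limitRecOn (motive := fun μ => Carrier P Ag μ → Prop) μ
    (fun _ => True)
    (fun _ ih w => ∀ A : Ag, (∀ v ∈ poss w A, ih v) ∧ (∀ v ∈ imposs w A, ih v))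
    (fun l hl ih w => (∀ (β : Ordinal.{0}) (hβ : β < l), ih β hβ (entry hl w β hβ)) ∧
      ∀ (γ β : Ordinal.{0}) (hγ : γ ≤ β) (hβ : β < l),
        LessPrecise (entry hl w γ (hγ.trans_lt hβ)) (entry hl w β hβ))

/-- One step of the simultaneous definition of the incompleted prebiworlds of depth `μ` (first
component) and the biworlds of depth `μ + 1` (second component), where `W` is the set of biworlds of
depth `μ`. -/
def levelStep {P : Type u} {Ag : Type v} {μ : Ordinal.{0}} (W : Set (Carrier P Ag μ)) :
    (Set (Carrier P Ag μ) × Set (Carrier P Ag (μ + 1))) →o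
      (Set (Carrier P Ag μ) × Set (Carrier P Ag (μ + 1))) where
  toFun X :=
    ({w | IsPrebiworld w ∧
        ∃ v₁ ∈ X.2, ∃ v₂ ∈ X.2, v₁ ≠ v₂ ∧ LessPrecise w v₁ ∧ LessPrecise w v₂},
      {w | IsPrebiworld w ∧
        ∀ A : Ag, poss w A ∪ imposs w A = W ∧ ∀ v ∈ poss w A ∩ imposs w A, v ∈ X.1})
  monotone' := by
    rintro X Y ⟨h₁, h₂⟩
    refine ⟨?_, ?_⟩
    · rintro w ⟨hw, v₁, hv₁, v₂, hv₂, h⟩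
      exact ⟨hw, v₁, h₂ hv₁, v₂, h₂ hv₂, h⟩
    · rintro w ⟨hw, h⟩
      exact ⟨hw, fun A => ⟨(h A).1, fun v hv => h₁ ((h A).2 v hv)⟩⟩

/-- The least pair of sets closed under the simultaneous definition: the incompleted prebiworlds of
depth `μ` and the biworlds of depth `μ + 1`, given the set `W` of biworlds of depth `μ`. -/
def level {P : Type u} {Ag : Type v} {μ : Ordinal.{0}} (W : Set (Carrier P Ag μ)) :
    Set (Carrier P Ag μ) × Set (Carrier P Ag (μ + 1)) :=
  OrderHom.lfp (levelStep W)

/-- The set of biworlds of depth `μ`, by transfinite recursion on `μ`. -/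
def biworlds (P : Type u) (Ag : Type v) (μ : Ordinal.{0}) : Set (Carrier P Ag μ) :=
  Ordinal.limitRecOn (motive := fun μ => Set (Carrier P Ag μ)) μ
    {w | IsPrebiworld w}
    (fun _ W => (level W).2)
    (fun l hl W => {w | IsPrebiworld w ∧
      ∀ (β : Ordinal.{0}) (hβ : β < l), entry hl w β hβ ∈ W β hβ})

/-- `w` is a biworld of depth `μ`. -/
def IsBiworld {P : Type u} {Ag : Type v} {μ : Ordinal.{0}} (w : Carrier P Ag μ) : Prop :=
  w ∈ biworlds P Ag μ

/-- `w` is an incompleted prebiworld of depth `μ`. -/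
def IsIncompleted {P : Type u} {Ag : Type v} {μ : Ordinal.{0}} (w : Carrier P Ag μ) : Prop :=
  w ∈ (level (biworlds P Ag μ)).1

/-- `w` is a completed prebiworld of depth `μ`. -/
def IsCompleted {P : Type u} {Ag : Type v} {μ : Ordinal.{0}} (w : Carrier P Ag μ) : Prop :=
  IsPrebiworld w ∧ ¬ IsIncompleted w

end EpistemicBiworld

namespace EpistemicBiworld

variable {P : Type u} {Ag : Type v}

/-! ### Unfolding the recursive definitions -/

/-! A completed biworld has at most one biworld extension one level up, so the point is existence.
The stronger fact that drives everything is that every biworld of countable depth has a decided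
extension, one in which each `A^v` is disjoint from `Ā^v` (`HasDecidedExtensions`). A decided
biworld is completed: in a further extension, each biworld must be placed on the side where its
restriction already lies. Hence the unique extension of a completed biworld is the decided one, and
is itself completed.

Decided extensions are built by splitting. At a successor depth, a point of `A^w ∩ Ā^w` is
incompleted, so it has two extensions and one can be sent to each side (`exists_split`). At a limit
depth, the sets form inverse sequences along a cofinal ω-sequence, and the threads are split
according to whether they eventually follow a fixed selector (`exists_split_of_inverse_limit`). This
is carried by an induction that also shows that biworlds restrict to biworlds and extend to every
larger countable depth. -/

theorem obj_zero (w : Carrier P Ag 0) : obj 0 w = zeroEquiv P Ag w :=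
  congrFun (Ordinal.limitRecOn_zero _ _ _) w

theorem obj_succ {μ : Ordinal.{0}} (w : Carrier P Ag (μ + 1)) :
    obj (μ + 1) w = (succEquiv P Ag μ w).1 := by
  rw [obj, Ordinal.limitRecOn_add_one]

theorem obj_limit {l : Ordinal.{0}} (hl : Order.IsSuccLimit l) (w : Carrier P Ag l) :
    obj l w = obj 0 (entry hl w 0 hl.bot_lt) := by
  rw [obj_zero, obj, Ordinal.limitRecOn_limit _ _ _ _ hl]

theorem ext_zero {v w : Carrier P Ag 0} (h : obj 0 v = obj 0 w) : v = w := by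
  rw [obj_zero, obj_zero] at h
  exact (zeroEquiv P Ag).injective h

theorem ext_succ {μ : Ordinal.{0}} {v w : Carrier P Ag (μ + 1)}
    (h : obj (μ + 1) v = obj (μ + 1) w) (hp : ∀ A, poss v A = poss w A)
    (hi : ∀ A, imposs v A = imposs w A) : v = w := by
  rw [obj_succ, obj_succ] at h
  exact (succEquiv P Ag μ).injective (Prod.ext h (Prod.ext (funext hp) (funext hi)))

theorem ext_limit {l : Ordinal.{0}} (hl : Order.IsSuccLimit l) {v w : Carrier P Ag l}
    (h : ∀ β hβ, entry hl v β hβ = entry hl w β hβ) : v = w :=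
  (limitEquiv P Ag hl).injective (funext fun β => funext fun hβ => h β hβ)

/-- The triple with the given components. -/
noncomputable def mkSucc {μ : Ordinal.{0}} (I : Set P) (S T : Ag → Set (Carrier P Ag μ)) :
    Carrier P Ag (μ + 1) :=
  (succEquiv P Ag μ).symm (I, S, T)

@[simp] theorem obj_mkSucc {μ : Ordinal.{0}} (I : Set P) (S T : Ag → Set (Carrier P Ag μ)) :
    obj (μ + 1) (mkSucc I S T) = I := by
  simp [obj_succ, mkSucc]

@[simp] theorem poss_mkSucc {μ : Ordinal.{0}} (I : Set P) (S T : Ag → Set (Carrier P Ag μ))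
    (A : Ag) : poss (mkSucc I S T) A = S A := by
  simp [poss, mkSucc]

@[simp] theorem imposs_mkSucc {μ : Ordinal.{0}} (I : Set P) (S T : Ag → Set (Carrier P Ag μ))
    (A : Ag) : imposs (mkSucc I S T) A = T A := by
  simp [imposs, mkSucc]

/-- The sequence with the given entries. -/
noncomputable def mkLimit {l : Ordinal.{0}} (hl : Order.IsSuccLimit l)
    (f : ∀ β : Ordinal.{0}, β < l → Carrier P Ag β) : Carrier P Ag l :=
  (limitEquiv P Ag hl).symm f

@[simp] theorem entry_mkLimit {l : Ordinal.{0}} (hl : Order.IsSuccLimit l)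
    (f : ∀ β : Ordinal.{0}, β < l → Carrier P Ag β) (β : Ordinal.{0}) (hβ : β < l) :
    entry hl (mkLimit hl f) β hβ = f β hβ := by
  simp [entry, mkLimit]

theorem obj_restrict_zero {μ : Ordinal.{0}} (w : Carrier P Ag μ) (h : 0 ≤ μ) :
    obj 0 (restrict w 0 h) = obj μ w := by
  have : restrict w 0 h = (zeroEquiv P Ag).symm (obj μ w) := by
    rw [restrict, restrictOf, Ordinal.limitRecOn_zero]
  rw [this, obj_zero, Equiv.apply_symm_apply]

theorem restrict_add_one_eq {μ : Ordinal.{0}} (w : Carrier P Ag μ) (α : Ordinal.{0})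
    (h : α + 1 ≤ μ) : restrict w (α + 1) h = restrictSucc μ α h w := by
  rw [restrict, restrictOf, Ordinal.limitRecOn_add_one]

theorem entry_restrict {μ l : Ordinal.{0}} (hl : Order.IsSuccLimit l) (w : Carrier P Ag μ)
    (h : l ≤ μ) (β : Ordinal.{0}) (hβ : β < l) :
    entry hl (restrict w l h) β hβ = restrict w β (hβ.le.trans h) := by
  have : restrict w l h =
      (limitEquiv P Ag hl).symm fun β hβ => restrict w β (hβ.le.trans h) := by
    rw [restrict, restrictOf, Ordinal.limitRecOn_limit _ _ _ _ hl]
    rfl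
  rw [this, entry, Equiv.apply_symm_apply]

theorem restrict_succ {μ α : Ordinal.{0}} (w : Carrier P Ag (μ + 1)) (h : α ≤ μ)
    (h' : α + 1 ≤ μ + 1) :
    restrict w (α + 1) h' = mkSucc (obj (μ + 1) w)
      (fun A => (fun x => restrict x α h) '' poss w A)
      (fun A => (fun x => restrict x α h) '' imposs w A) := by
  rw [restrict_add_one_eq, restrictSucc, Ordinal.limitRecOn_add_one]
  rfl

theorem restrict_limit_succ {l α : Ordinal.{0}} (hl : Order.IsSuccLimit l) (w : Carrier P Ag l)
    (h : α + 1 ≤ l) (h' : α + 1 < l) :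
    restrict w (α + 1) h = entry hl w (α + 1) h' := by
  rw [restrict_add_one_eq, restrictSucc, Ordinal.limitRecOn_limit _ _ _ _ hl]

theorem isPrebiworld_zero (w : Carrier P Ag 0) : IsPrebiworld w := by
  rw [IsPrebiworld, Ordinal.limitRecOn_zero]
  trivial

theorem isPrebiworld_succ {μ : Ordinal.{0}} {w : Carrier P Ag (μ + 1)} :
    IsPrebiworld w ↔ ∀ A : Ag, (∀ v ∈ poss w A, IsPrebiworld v) ∧
      (∀ v ∈ imposs w A, IsPrebiworld v) := by
  rw [IsPrebiworld, Ordinal.limitRecOn_add_one]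
  rfl

theorem isPrebiworld_limit {l : Ordinal.{0}} (hl : Order.IsSuccLimit l) {w : Carrier P Ag l} :
    IsPrebiworld w ↔ (∀ (β : Ordinal.{0}) (hβ : β < l), IsPrebiworld (entry hl w β hβ)) ∧
      ∀ (γ β : Ordinal.{0}) (hγ : γ ≤ β) (hβ : β < l),
        LessPrecise (entry hl w γ (hγ.trans_lt hβ)) (entry hl w β hβ) := by
  rw [IsPrebiworld, Ordinal.limitRecOn_limit _ _ _ _ hl]
  rfl

theorem isBiworld_zero (w : Carrier P Ag 0) : IsBiworld w := by
  have : biworlds P Ag 0 = {w | IsPrebiworld w} := Ordinal.limitRecOn_zero _ _ _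
  rw [IsBiworld, this]
  exact isPrebiworld_zero w

theorem biworlds_succ (μ : Ordinal.{0}) :
    biworlds P Ag (μ + 1) = (level (biworlds P Ag μ)).2 :=
  Ordinal.limitRecOn_add_one _ _ _ _

theorem isBiworld_limit {l : Ordinal.{0}} (hl : Order.IsSuccLimit l) {w : Carrier P Ag l} :
    IsBiworld w ↔ IsPrebiworld w ∧ ∀ β hβ, IsBiworld (entry hl w β hβ) := by
  have : biworlds P Ag l = {w | IsPrebiworld w ∧
      ∀ (β : Ordinal.{0}) (hβ : β < l), entry hl w β hβ ∈ biworlds P Ag β} :=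
    Ordinal.limitRecOn_limit _ _ _ _ hl
  rw [IsBiworld, this]
  rfl

/-- A least fixed point satisfies its own equation. This and `isIncompleted_iff` are all that the
proof uses about `level`; minimality plays no role. -/
theorem isBiworld_succ {μ : Ordinal.{0}} {w : Carrier P Ag (μ + 1)} :
    IsBiworld w ↔ IsPrebiworld w ∧ ∀ A : Ag,
      (∀ x, IsBiworld x ↔ x ∈ poss w A ∨ x ∈ imposs w A) ∧
      ∀ x, x ∈ poss w A → x ∈ imposs w A → IsIncompleted x := by
  have : biworlds P Ag (μ + 1) = (levelStep (biworlds P Ag μ) (level (biworlds P Ag μ))).2 := by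
    rw [biworlds_succ, level, OrderHom.map_lfp]
  rw [IsBiworld, this]
  change (IsPrebiworld w ∧ ∀ A : Ag, poss w A ∪ imposs w A = biworlds P Ag μ ∧
    ∀ v ∈ poss w A ∩ imposs w A, IsIncompleted v) ↔ _
  refine and_congr_right fun _ => forall_congr' fun A => and_congr ?_ ?_
  · rw [eq_comm, Set.ext_iff]
    rfl
  · simp [and_imp]

theorem isIncompleted_iff {μ : Ordinal.{0}} {w : Carrier P Ag μ} :
    IsIncompleted w ↔ IsPrebiworld w ∧ ∃ v₁ v₂ : Carrier P Ag (μ + 1),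
      IsBiworld v₁ ∧ IsBiworld v₂ ∧ v₁ ≠ v₂ ∧ LessPrecise w v₁ ∧ LessPrecise w v₂ := by
  have : level (biworlds P Ag μ) = levelStep (biworlds P Ag μ) (level (biworlds P Ag μ)) := by
    rw [level, OrderHom.map_lfp]
  rw [IsIncompleted, this]
  change (IsPrebiworld w ∧ ∃ v₁ ∈ (level (biworlds P Ag μ)).2, ∃ v₂ ∈ (level (biworlds P Ag μ)).2,
    v₁ ≠ v₂ ∧ LessPrecise w v₁ ∧ LessPrecise w v₂) ↔ _
  rw [← biworlds_succ]
  refine and_congr_right fun _ => ⟨?_, ?_⟩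
  · rintro ⟨v₁, h₁, v₂, h₂, h⟩
    exact ⟨v₁, v₂, h₁, h₂, h⟩
  · rintro ⟨v₁, v₂, h₁, h₂, h⟩
    exact ⟨v₁, h₁, v₂, h₂, h⟩

theorem IsBiworld.isPrebiworld {μ : Ordinal.{0}} {w : Carrier P Ag μ} (hw : IsBiworld w) :
    IsPrebiworld w := by
  induction μ using Ordinal.limitRecOn with
  | zero => exact isPrebiworld_zero w
  | add_one μ _ => exact (isBiworld_succ.mp hw).1
  | limit l hl _ => exact ((isBiworld_limit hl).mp hw).1

/-! ### Restrictions of prebiworlds -/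

theorem obj_restrict {μ : Ordinal.{0}} {w : Carrier P Ag μ} (hw : IsPrebiworld w)
    (α : Ordinal.{0}) (h : α ≤ μ) : obj α (restrict w α h) = obj μ w := by
  induction α using Ordinal.limitRecOn with
  | zero => exact obj_restrict_zero w h
  | limit l hl _ => rw [obj_limit hl, entry_restrict, obj_restrict_zero]
  | add_one α _ =>
    induction μ using Ordinal.limitRecOn with
    | zero => exact absurd (Order.add_one_le_iff.mp h) not_lt_bot
    | add_one μ _ => rw [restrict_succ w (by simpa using h), obj_mkSucc]
    | limit l hl _ =>
      have h' := hl.add_one_lt (Order.add_one_le_iff.mp h)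
      obtain ⟨h0, e⟩ := ((isPrebiworld_limit hl).mp hw).2 0 (α + 1) bot_le h'
      rw [restrict_limit_succ hl w h h', obj_limit hl w, ← e, obj_restrict_zero]

/-- At successor depths images compose; at limit depths this is the coherence imposed by
`IsPrebiworld`, since elements of the carrier are otherwise arbitrary sequences. -/
theorem restrict_restrict {μ : Ordinal.{0}} {w : Carrier P Ag μ} (hw : IsPrebiworld w)
    {α β : Ordinal.{0}} (hα : α ≤ β) (hβ : β ≤ μ) :
    restrict (restrict w β hβ) α hα = restrict w α (hα.trans hβ) := by
  induction μ using Ordinal.limitRecOn generalizing α β with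
  | zero =>
    obtain rfl : β = 0 := by simpa using hβ
    obtain rfl : α = 0 := by simpa using hα
    apply ext_zero
    simp [obj_restrict_zero]
  | add_one μ ih =>
    induction α using Ordinal.limitRecOn with
    | zero =>
      apply ext_zero
      rw [obj_restrict_zero, obj_restrict_zero, obj_restrict hw]
    | limit l hl ihl =>
      refine ext_limit hl fun γ hγ => ?_
      rw [entry_restrict, entry_restrict, ihl γ hγ]
    | add_one α _ =>
      induction β using Ordinal.limitRecOn with
      | zero => exact absurd (Order.add_one_le_iff.mp hα) not_lt_bot
      | add_one β _ =>
        have hα' : α ≤ β := by simpa using hα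
        have hβ' : β ≤ μ := by simpa using hβ
        rw [restrict_succ w hβ' hβ, restrict_succ _ hα', restrict_succ w (hα'.trans hβ')]
        rw [isPrebiworld_succ] at hw
        apply ext_succ
        · simp
        · intro A
          simp only [poss_mkSucc, Set.image_image]
          exact Set.image_congr fun x hx => ih ((hw A).1 x hx) hα' hβ'
        · intro A
          simp only [imposs_mkSucc, Set.image_image]
          exact Set.image_congr fun x hx => ih ((hw A).2 x hx) hα' hβ'
      | limit l hl _ =>
        rw [restrict_limit_succ hl _ hα (hl.add_one_lt (Order.add_one_le_iff.mp hα)),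
          entry_restrict]
  | limit m hm ih =>
    induction α using Ordinal.limitRecOn with
    | zero =>
      apply ext_zero
      rw [obj_restrict_zero, obj_restrict_zero, obj_restrict hw]
    | limit l hl ihl =>
      refine ext_limit hl fun γ hγ => ?_
      rw [entry_restrict, entry_restrict, ihl γ hγ]
    | add_one α _ =>
      induction β using Ordinal.limitRecOn with
      | zero => exact absurd (Order.add_one_le_iff.mp hα) not_lt_bot
      | add_one β _ =>
        have hβ' := hm.add_one_lt (Order.add_one_le_iff.mp hβ)
        rw [restrict_limit_succ hm w hβ hβ', restrict_limit_succ hm w _ (hα.trans_lt hβ')]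
        exact (((isPrebiworld_limit hm).mp hw).2 _ _ hα hβ').2
      | limit l hl _ =>
        rw [restrict_limit_succ hl _ hα (hl.add_one_lt (Order.add_one_le_iff.mp hα)),
          entry_restrict]

theorem restrict_self {μ : Ordinal.{0}} {w : Carrier P Ag μ} (hw : IsPrebiworld w) :
    restrict w μ le_rfl = w := by
  induction μ using Ordinal.limitRecOn with
  | zero => exact ext_zero (obj_restrict_zero _ _)
  | add_one μ ih =>
    rw [isPrebiworld_succ] at hw
    rw [restrict_succ w le_rfl]
    apply ext_succ
    · simp
    · intro A
      rw [poss_mkSucc]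
      exact (Set.image_congr fun x hx => ih ((hw A).1 x hx)).trans (Set.image_id _)
    · intro A
      rw [imposs_mkSucc]
      exact (Set.image_congr fun x hx => ih ((hw A).2 x hx)).trans (Set.image_id _)
  | limit l hl _ =>
    refine ext_limit hl fun β hβ => ?_
    rw [entry_restrict]
    induction β using Ordinal.limitRecOn with
    | zero =>
      apply ext_zero
      rw [obj_restrict_zero, obj_limit hl]
    | add_one β _ => exact restrict_limit_succ hl w _ _
    | limit m hm ih =>
      -- The reflexive case of coherence makes entry `m` equal to its own restriction, so it can be
      -- compared entry by entry.
      obtain ⟨_, e⟩ := ((isPrebiworld_limit hl).mp hw).2 m m le_rfl hβ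
      rw [← e]
      refine ext_limit hm fun γ hγ => ?_
      rw [entry_restrict, entry_restrict, ih γ hγ (hγ.trans hβ)]
      exact (((isPrebiworld_limit hl).mp hw).2 γ m hγ.le hβ).2.symm

theorem entry_eq_restrict {l : Ordinal.{0}} (hl : Order.IsSuccLimit l) {w : Carrier P Ag l}
    (hw : IsPrebiworld w) (β : Ordinal.{0}) (hβ : β < l) :
    entry hl w β hβ = restrict w β hβ.le := by
  rw [← entry_restrict hl w le_rfl β hβ, restrict_self hw]

theorem IsPrebiworld.restrict {μ : Ordinal.{0}} {w : Carrier P Ag μ} (hw : IsPrebiworld w)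
    (α : Ordinal.{0}) (h : α ≤ μ) : IsPrebiworld (restrict w α h) := by
  induction μ using Ordinal.limitRecOn generalizing α with
  | zero =>
    obtain rfl : α = 0 := by simpa using h
    exact isPrebiworld_zero _
  | add_one μ ih =>
    induction α using Ordinal.limitRecOn with
    | zero => exact isPrebiworld_zero _
    | add_one α _ =>
      have h' : α ≤ μ := by simpa using h
      rw [restrict_succ w h', isPrebiworld_succ]
      rw [isPrebiworld_succ] at hw
      intro A
      simp only [poss_mkSucc, imposs_mkSucc, Set.forall_mem_image]
      exact ⟨fun x hx => ih ((hw A).1 x hx) α h', fun x hx => ih ((hw A).2 x hx) α h'⟩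
    | limit l hl ihl =>
      rw [isPrebiworld_limit hl]
      refine ⟨fun β hβ => ?_, fun γ β hγ hβ => ?_⟩
      · rw [entry_restrict]
        exact ihl β hβ _
      · rw [entry_restrict, entry_restrict]
        exact ⟨hγ, restrict_restrict hw _ _⟩
  | limit l hl _ =>
    rcases h.lt_or_eq with h' | rfl
    · rw [← entry_eq_restrict hl hw α h']
      exact ((isPrebiworld_limit hl).mp hw).1 α h'
    · rwa [restrict_self hw]

theorem mem_poss_restrict {μ α : Ordinal.{0}} (w : Carrier P Ag (μ + 1)) (h : α ≤ μ)
    (h' : α + 1 ≤ μ + 1) (A : Ag) (x : Carrier P Ag α) :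
    x ∈ poss (restrict w (α + 1) h') A ↔ ∃ y ∈ poss w A, restrict y α h = x := by
  rw [restrict_succ w h, poss_mkSucc]
  rfl

theorem mem_imposs_restrict {μ α : Ordinal.{0}} (w : Carrier P Ag (μ + 1)) (h : α ≤ μ)
    (h' : α + 1 ≤ μ + 1) (A : Ag) (x : Carrier P Ag α) :
    x ∈ imposs (restrict w (α + 1) h') A ↔ ∃ y ∈ imposs w A, restrict y α h = x := by
  rw [restrict_succ w h, imposs_mkSucc]
  rfl

theorem ext_restrict_limit {l : Ordinal.{0}} (hl : Order.IsSuccLimit l) {v w : Carrier P Ag l}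
    (hv : IsPrebiworld v) (hw : IsPrebiworld w)
    (h : ∀ β (hβ : β + 1 < l), restrict v (β + 1) hβ.le = restrict w (β + 1) hβ.le) : v = w := by
  refine ext_limit hl fun β hβ => ?_
  have hβ' := hl.add_one_lt hβ
  rw [entry_eq_restrict hl hv, entry_eq_restrict hl hw,
    ← restrict_restrict hv le_self_add hβ'.le, h β hβ', restrict_restrict hw]

/-! ### Splitting lemmas -/

/-- A surjection onto `S ∪ T` with at least two points above each point of `S ∩ T` splits into
surjections onto `S` and `T`. -/
theorem exists_split {X Y : Type*} {r : Y → X} {W : Set Y} {S T : Set X}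
    (hr : ∀ y ∈ W, r y ∈ S ∨ r y ∈ T) (hS : ∀ x ∈ S, ∃ y ∈ W, r y = x)
    (hT : ∀ x ∈ T, ∃ y ∈ W, r y = x)
    (h₂ : ∀ x ∈ S, x ∈ T → ∃ y ∈ W, ∃ z ∈ W, y ≠ z ∧ r y = x ∧ r z = x) :
    ∃ C D : Set Y, (∀ y, y ∈ W ↔ y ∈ C ∨ y ∈ D) ∧ (∀ y ∈ C, y ∉ D) ∧
      (∀ x, x ∈ S ↔ ∃ y ∈ C, r y = x) ∧ (∀ x, x ∈ T ↔ ∃ y ∈ D, r y = x) := by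
  have : ∀ x : X, ∃ c : Set Y, x ∈ S → x ∈ T →
      (∃ y ∈ W, y ∈ c ∧ r y = x) ∧ ∃ z ∈ W, z ∉ c ∧ r z = x := by
    intro x
    by_cases hx : x ∈ S ∧ x ∈ T
    -- Over a common point, `c x` cuts the fibre into two nonempty pieces; elsewhere the side is
    -- forced and `c x` is irrelevant.
    · obtain ⟨y, hy, z, hz, hne, hyx, hzx⟩ := h₂ x hx.1 hx.2
      exact ⟨{y}, fun _ _ => ⟨⟨y, hy, rfl, hyx⟩, z, hz, fun e => hne e.symm, hzx⟩⟩
    · exact ⟨∅, fun h h' => absurd ⟨h, h'⟩ hx⟩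
  choose c hc using this
  refine ⟨{y | y ∈ W ∧ r y ∈ S ∧ (r y ∉ T ∨ y ∈ c (r y))},
    {y | y ∈ W ∧ r y ∈ T ∧ (r y ∉ S ∨ y ∉ c (r y))}, ?_, ?_, ?_, ?_⟩
  · intro y
    have := hr y
    simp only [Set.mem_ofPred_eq]
    tauto
  · rintro y ⟨_, _, _⟩ ⟨_, _, _⟩
    tauto
  · refine fun x => ⟨fun hx => ?_, ?_⟩
    · by_cases hx' : x ∈ T
      · obtain ⟨⟨y, hy, hyc, rfl⟩, _⟩ := hc x hx hx'
        exact ⟨y, ⟨hy, hx, Or.inr hyc⟩, rfl⟩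
      · obtain ⟨y, hy, rfl⟩ := hS x hx
        exact ⟨y, ⟨hy, hx, Or.inl hx'⟩, rfl⟩
    · rintro ⟨y, hy, rfl⟩
      exact hy.2.1
  · refine fun x => ⟨fun hx => ?_, ?_⟩
    · by_cases hx' : x ∈ S
      · obtain ⟨_, y, hy, hyc, rfl⟩ := hc x hx' hx
        exact ⟨y, ⟨hy, hx, Or.inr hyc⟩, rfl⟩
      · obtain ⟨y, hy, rfl⟩ := hT x hx
        exact ⟨y, ⟨hy, hx, Or.inl hx'⟩, rfl⟩
    · rintro ⟨y, hy, rfl⟩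
      exact hy.2.1

/-- Two inverse subsystems `S`, `T` covering an inverse sequence `V`, such that every point of
`S n ∩ T n` has at least two points above it, are the projections of two disjoint sets that cover
the inverse limit. -/
theorem exists_split_of_inverse_limit {X : ℕ → Type*} {Y : Type*} [∀ n, Nonempty (X n)]
    {r : ∀ n, X (n + 1) → X n} {p : ∀ n, Y → X n} {W : Set Y} {V S T : ∀ n, Set (X n)}
    (hV : ∀ n x, x ∈ V n ↔ x ∈ S n ∨ x ∈ T n)
    (hpV : ∀ n, ∀ y ∈ W, p n y ∈ V n)
    (hp : ∀ n, ∀ y ∈ W, r n (p (n + 1) y) = p n y)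
    (hglue : ∀ n (z : ∀ k, X (n + k)), (∀ k, z k ∈ V (n + k)) →
      (∀ k, r (n + k) (z (k + 1)) = z k) → ∃ y ∈ W, ∀ k, p (n + k) y = z k)
    (hrS : ∀ n, ∀ x ∈ S (n + 1), r n x ∈ S n) (hrT : ∀ n, ∀ x ∈ T (n + 1), r n x ∈ T n)
    (hS : ∀ n, ∀ x ∈ S n, ∃ y ∈ S (n + 1), r n y = x)
    (hT : ∀ n, ∀ x ∈ T n, ∃ y ∈ T (n + 1), r n y = x)
    (h₂ : ∀ n, ∀ x ∈ S n, x ∈ T n →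
      ∃ y ∈ V (n + 1), ∃ z ∈ V (n + 1), y ≠ z ∧ r n y = x ∧ r n z = x) :
    ∃ C D : Set Y, (∀ y, y ∈ W ↔ y ∈ C ∨ y ∈ D) ∧ (∀ y ∈ C, y ∉ D) ∧
      (∀ n x, x ∈ S n ↔ ∃ y ∈ C, p n y = x) ∧ (∀ n x, x ∈ T n ↔ ∃ y ∈ D, p n y = x) := by
  have hab : ∀ n (x : X n), ∃ a b : X (n + 1), (x ∈ S n → a ∈ S (n + 1) ∧ r n a = x) ∧
      (x ∈ T n → b ∈ T (n + 1) ∧ r n b = x) ∧ (x ∈ S n → x ∈ T n → a ≠ b) := by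
    intro n x
    by_cases hxS : x ∈ S n <;> by_cases hxT : x ∈ T n
    · obtain ⟨a, ha, hax⟩ := hS n x hxS
      obtain ⟨b, hb, hbx⟩ := hT n x hxT
      by_cases hne : a = b
      · subst hne
        -- If both selectors hit the same point, a second point of the fibre replaces whichever of
        -- them belongs to its side.
        obtain ⟨c, hc, hcx, hca⟩ : ∃ c ∈ V (n + 1), r n c = x ∧ c ≠ a := by
          obtain ⟨y, hy, z, hz, hyz, hyx, hzx⟩ := h₂ n x hxS hxT
          by_cases h : y = a
          · exact ⟨z, hz, hzx, fun e => hyz (h.trans e.symm)⟩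
          · exact ⟨y, hy, hyx, h⟩
        rcases (hV _ _).mp hc with hc | hc
        · exact ⟨c, a, fun _ => ⟨hc, hcx⟩, fun _ => ⟨hb, hbx⟩, fun _ _ => hca⟩
        · exact ⟨a, c, fun _ => ⟨ha, hax⟩, fun _ => ⟨hc, hcx⟩, fun _ _ => hca.symm⟩
      · exact ⟨a, b, fun _ => ⟨ha, hax⟩, fun _ => ⟨hb, hbx⟩, fun _ _ => hne⟩
    · obtain ⟨a, ha, hax⟩ := hS n x hxS
      exact ⟨a, a, fun _ => ⟨ha, hax⟩, fun h => absurd h hxT, fun _ h => absurd h hxT⟩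
    · obtain ⟨b, hb, hbx⟩ := hT n x hxT
      exact ⟨b, b, fun h => absurd h hxS, fun _ => ⟨hb, hbx⟩, fun h => absurd h hxS⟩
    · obtain ⟨a⟩ := (inferInstance : Nonempty (X (n + 1)))
      exact ⟨a, a, fun h => absurd h hxS, fun h => absurd h hxT, fun h => absurd h hxS⟩
  choose a b ha hb hne using hab
  have down : ∀ {U : ∀ n, Set (X n)}, (∀ n, ∀ x ∈ U (n + 1), r n x ∈ U n) → ∀ y ∈ W, ∀ {m n},
      m ≤ n → p n y ∈ U n → p m y ∈ U m := by
    intro U hU y hy m n hmn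
    induction n, hmn using Nat.le_induction with
    | base => exact id
    | succ n _ ih => exact fun h => ih (hp n y hy ▸ hU n _ h)
  have follow : ∀ {U : ∀ n, Set (X n)} (c : ∀ n, X n → X (n + 1)),
      (∀ n, ∀ x ∈ U (n + 1), r n x ∈ U n) → (∀ n, ∀ x ∈ U n, x ∈ V n) →
      (∀ n x, x ∈ U n → c n x ∈ U (n + 1) ∧ r n (c n x) = x) → ∀ n, ∀ x ∈ U n,
      ∃ y ∈ W, p n y = x ∧ (∀ m, p m y ∈ U m) ∧ ∀ m ≥ n, p (m + 1) y = c m (p m y) := by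
    intro U c hU hUV hc n x hx
    -- Iterating the selector from `x` gives a thread starting at level `n`; the levels below follow
    -- by projection.
    let z : ∀ k, X (n + k) := fun k => Nat.rec x (fun k y => c (n + k) y) k
    have hz : ∀ k, z k ∈ U (n + k) := fun k => by
      induction k with
      | zero => exact hx
      | succ k ih => exact (hc _ _ ih).1
    obtain ⟨y, hy, hyz⟩ := hglue n z (fun k => hUV _ _ (hz k)) fun k => (hc _ _ (hz k)).2
    refine ⟨y, hy, hyz 0, fun m => ?_, fun m hm => ?_⟩
    · refine down hU y hy (Nat.le_add_left m n) ?_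
      rw [hyz]
      exact hz m
    · obtain ⟨k, rfl⟩ := Nat.exists_eq_add_of_le hm
      rw [hyz k]
      exact hyz (k + 1)
  have cover : ∀ y ∈ W, (∀ n, p n y ∈ S n) ∨ ∀ n, p n y ∈ T n := by
    intro y hy
    by_contra! h
    obtain ⟨⟨m, hm⟩, n, hn⟩ := h
    rcases (hV _ _).mp (hpV (max m n) y hy) with h | h
    · exact hm (down hrS y hy (le_max_left m n) h)
    · exact hn (down hrT y hy (le_max_right m n) h)
  -- A thread lying in both systems goes to the first set exactly when it eventually follows `a`.
  -- Threads that eventually follow `b` then fall in the second, because `a` and `b` differ at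
  -- common points.
  refine ⟨{y | y ∈ W ∧ (∀ n, p n y ∈ S n) ∧
      ((∃ n, p n y ∉ T n) ∨ ∃ m, ∀ n ≥ m, p (n + 1) y = a n (p n y))},
    {y | y ∈ W ∧ (∀ n, p n y ∈ T n) ∧
      ((∃ n, p n y ∉ S n) ∨ ¬ ∃ m, ∀ n ≥ m, p (n + 1) y = a n (p n y))}, ?_, ?_, ?_, ?_⟩
  · intro y
    have := cover y
    simp only [Set.mem_ofPred_eq, ← not_forall]
    tauto
  · rintro y ⟨_, h₁, h₂⟩ ⟨_, h₃, h₄⟩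
    simp only [← not_forall] at h₂ h₄
    tauto
  · refine fun n x => ⟨fun hx => ?_, ?_⟩
    · obtain ⟨y, hy, hyx, hyS, hya⟩ :=
        follow a hrS (fun n x h => (hV n x).mpr (Or.inl h)) ha n x hx
      exact ⟨y, ⟨hy, hyS, Or.inr ⟨n, hya⟩⟩, hyx⟩
    · rintro ⟨y, hy, rfl⟩
      exact hy.2.1 n
  · refine fun n x => ⟨fun hx => ?_, ?_⟩
    · obtain ⟨y, hy, hyx, hyT, hyb⟩ :=
        follow b hrT (fun n x h => (hV n x).mpr (Or.inr h)) hb n x hx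
      refine ⟨y, ⟨hy, hyT, ?_⟩, hyx⟩
      by_contra! h
      obtain ⟨hyS, m, hya⟩ := h
      exact hne _ _ (hyS (max m n)) (hyT _) ((hya _ (le_max_left m n)).symm.trans
        (hyb _ (le_max_right m n)))
    · rintro ⟨y, hy, rfl⟩
      exact hy.2.1 n

/-! ### Decided biworlds -/

/-- `w` is decided if no `A^w` meets `Ā^w`. -/
def IsDecided {μ : Ordinal.{0}} (w : Carrier P Ag (μ + 1)) : Prop :=
  ∀ A, ∀ x ∈ poss w A, x ∉ imposs w A

/-- Every biworld of depth `β` lies on some side of each `uᵢ`, and its restriction to `α` rules out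
one side in the common decided restriction. No freedom is left. -/
theorem IsDecided.eq_of_restrict_eq {α β : Ordinal.{0}} (h : α ≤ β) (h' : α + 1 ≤ β + 1)
    {u₁ u₂ : Carrier P Ag (β + 1)} (hu₁ : IsBiworld u₁) (hu₂ : IsBiworld u₂)
    (hd : IsDecided (restrict u₁ (α + 1) h'))
    (e : restrict u₁ (α + 1) h' = restrict u₂ (α + 1) h') : u₁ = u₂ := by
  have hd₂ := e ▸ hd
  rw [isBiworld_succ] at hu₁ hu₂
  refine ext_succ ?_ (fun A => Set.ext fun x => ⟨fun hx => ?_, fun hx => ?_⟩)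
    (fun A => Set.ext fun x => ⟨fun hx => ?_, fun hx => ?_⟩)
  · rw [← obj_restrict hu₁.1 _ h', e, obj_restrict hu₂.1]
  · refine ((hu₂.2 A).1 x |>.mp (((hu₁.2 A).1 x).mpr (Or.inl hx))).resolve_right fun hx' => ?_
    refine hd A (restrict x α h) ((mem_poss_restrict _ h _ _ _).mpr ⟨x, hx, rfl⟩) ?_
    exact e ▸ (mem_imposs_restrict _ h _ _ _).mpr ⟨x, hx', rfl⟩
  · refine ((hu₁.2 A).1 x |>.mp (((hu₂.2 A).1 x).mpr (Or.inl hx))).resolve_right fun hx' => ?_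
    refine hd A (restrict x α h) ?_ ((mem_imposs_restrict _ h _ _ _).mpr ⟨x, hx', rfl⟩)
    exact e ▸ (mem_poss_restrict _ h _ _ _).mpr ⟨x, hx, rfl⟩
  · refine ((hu₂.2 A).1 x |>.mp (((hu₁.2 A).1 x).mpr (Or.inr hx))).resolve_left fun hx' => ?_
    refine hd A (restrict x α h) ?_ ((mem_imposs_restrict _ h _ _ _).mpr ⟨x, hx, rfl⟩)
    exact e ▸ (mem_poss_restrict _ h _ _ _).mpr ⟨x, hx', rfl⟩
  · refine ((hu₁.2 A).1 x |>.mp (((hu₂.2 A).1 x).mpr (Or.inr hx))).resolve_left fun hx' => ?_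
    refine hd A (restrict x α h) ((mem_poss_restrict _ h _ _ _).mpr ⟨x, hx', rfl⟩) ?_
    exact e ▸ (mem_imposs_restrict _ h _ _ _).mpr ⟨x, hx, rfl⟩

theorem IsDecided.not_isIncompleted {α β : Ordinal.{0}} (h : α + 1 ≤ β)
    {z : Carrier P Ag β} (hd : IsDecided (restrict z (α + 1) h)) : ¬ IsIncompleted z := by
  rw [isIncompleted_iff]
  rintro ⟨_, v₁, v₂, h₁, h₂, hne, ⟨hβ, e₁⟩, ⟨_, e₂⟩⟩
  have e₁' := restrict_restrict h₁.isPrebiworld h hβ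
  have e₂' := restrict_restrict h₂.isPrebiworld h hβ
  rw [e₁] at e₁'
  rw [e₂] at e₂'
  refine hne (IsDecided.eq_of_restrict_eq (le_self_add.trans h) (h.trans hβ) h₁ h₂ ?_ ?_)
  · rwa [← e₁']
  · rw [← e₁', ← e₂']

theorem eq_of_not_isIncompleted {α : Ordinal.{0}} {x : Carrier P Ag α} (hx : IsPrebiworld x)
    (hc : ¬ IsIncompleted x) {v₁ v₂ : Carrier P Ag (α + 1)} (h₁ : IsBiworld v₁)
    (h₂ : IsBiworld v₂) (e₁ : LessPrecise x v₁) (e₂ : LessPrecise x v₂) : v₁ = v₂ := by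
  by_contra hne
  exact hc (isIncompleted_iff.mpr ⟨hx, v₁, v₂, h₁, h₂, hne, e₁, e₂⟩)

variable (P Ag) in
/-- All restrictions of biworlds of depth `μ` are biworlds. -/
def RestrictsToBiworlds (μ : Ordinal.{0}) : Prop :=
  ∀ (α : Ordinal.{0}) (h : α ≤ μ) (w : Carrier P Ag μ), IsBiworld w → IsBiworld (restrict w α h)

variable (P Ag) in
/-- All biworlds of depth at most `μ` extend to biworlds of depth `μ`. -/
def ExtendsBiworlds (μ : Ordinal.{0}) : Prop :=
  ∀ (α : Ordinal.{0}) (h : α ≤ μ) (x : Carrier P Ag α), IsBiworld x →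
    ∃ z : Carrier P Ag μ, IsBiworld z ∧ restrict z α h = x

variable (P Ag) in
/-- All biworlds of depth `μ` have a decided extension of depth `μ + 1`. -/
def HasDecidedExtensions (μ : Ordinal.{0}) : Prop :=
  ∀ w : Carrier P Ag μ, IsBiworld w →
    ∃ v : Carrier P Ag (μ + 1), IsBiworld v ∧ IsDecided v ∧ restrict v μ le_self_add = w

/-- Uniqueness of the extension identifies `v` with the decided one. -/
theorem HasDecidedExtensions.isDecided {α : Ordinal.{0}} (hE : HasDecidedExtensions P Ag α)
    {x : Carrier P Ag α} (hx : IsBiworld x) (hc : ¬ IsIncompleted x) {v : Carrier P Ag (α + 1)}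
    (hv : IsBiworld v) (e : LessPrecise x v) : IsDecided v := by
  obtain ⟨v', hv', hd, e'⟩ := hE x hx
  rwa [eq_of_not_isIncompleted hx.isPrebiworld hc hv hv' e ⟨_, e'⟩]

/-- All extensions of a completed biworld to a given depth coincide and are completed. -/
theorem extension_unique {α β : Ordinal.{0}} (h : α < β) (hE : HasDecidedExtensions P Ag α)
    (hR : RestrictsToBiworlds P Ag β) {x : Carrier P Ag α} (hx : IsBiworld x)
    (hc : ¬ IsIncompleted x) {z₁ z₂ : Carrier P Ag β} (h₁ : IsBiworld z₁) (h₂ : IsBiworld z₂)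
    (e₁ : restrict z₁ α h.le = x) (e₂ : restrict z₂ α h.le = x) :
    z₁ = z₂ ∧ ¬ IsIncompleted z₁ := by
  have hα : α + 1 ≤ β := Order.add_one_le_iff.mpr h
  have l₁ : LessPrecise x (restrict z₁ (α + 1) hα) :=
    ⟨le_self_add, (restrict_restrict h₁.isPrebiworld _ _).trans e₁⟩
  have l₂ : LessPrecise x (restrict z₂ (α + 1) hα) :=
    ⟨le_self_add, (restrict_restrict h₂.isPrebiworld _ _).trans e₂⟩
  have hd := hE.isDecided hx hc (hR _ hα _ h₁) l₁
  have e := eq_of_not_isIncompleted hx.isPrebiworld hc (hR _ hα _ h₁) (hR _ hα _ h₂) l₁ l₂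
  refine ⟨?_, hd.not_isIncompleted hα⟩
  induction β using Ordinal.limitRecOn with
  | zero => exact absurd h not_lt_bot
  | add_one β _ => exact IsDecided.eq_of_restrict_eq (by simpa using hα) hα h₁ h₂ hd e
  | limit l hl _ =>
    -- From `α` on, the decided restriction at `α + 1` determines depth `γ + 1`; below `α`, both
    -- sides are restrictions of `x`.
    refine ext_restrict_limit hl h₁.isPrebiworld h₂.isPrebiworld fun γ hγ => ?_
    rcases le_or_gt α γ with hαγ | hγα
    · have hαγ' : α + 1 ≤ γ + 1 := by simpa using hαγ
      refine IsDecided.eq_of_restrict_eq hαγ hαγ' (hR _ _ _ h₁) (hR _ _ _ h₂) ?_ ?_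
      · rwa [restrict_restrict h₁.isPrebiworld]
      · rw [restrict_restrict h₁.isPrebiworld, e, restrict_restrict h₂.isPrebiworld]
    · rw [← restrict_restrict h₁.isPrebiworld (Order.add_one_le_iff.mpr hγα) h.le, e₁, ← e₂,
        restrict_restrict h₂.isPrebiworld]

/-! ### Zero and successor depths -/

theorem HasDecidedExtensions.zero : HasDecidedExtensions P Ag 0 := by
  intro w _
  refine ⟨mkSucc (obj 0 w) (fun _ => Set.univ) (fun _ => ∅), ?_, ?_, ?_⟩
  · rw [isBiworld_succ, isPrebiworld_succ]
    refine ⟨fun A => ?_, fun A => ⟨fun x => ?_, fun x => ?_⟩⟩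
    · simp [isPrebiworld_zero]
    · simp [isBiworld_zero]
    · simp
  · intro A x
    simp
  · apply ext_zero
    rw [obj_restrict_zero, obj_mkSucc]

/-- Covering survives restriction because every biworld of depth `α` lifts to depth `μ`. The danger
is that restriction creates overlaps: a completed point could be the image of elements from both
sides. -/
theorem RestrictsToBiworlds.succ {μ : Ordinal.{0}} (hR : RestrictsToBiworlds P Ag μ)
    (hX : ExtendsBiworlds P Ag μ) (hE : ∀ α < μ, HasDecidedExtensions P Ag α) :
    RestrictsToBiworlds P Ag (μ + 1) := by
  intro α h w hw
  induction α using Ordinal.limitRecOn with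
  | zero => exact isBiworld_zero _
  | limit l hl ih =>
    rw [isBiworld_limit hl]
    refine ⟨hw.isPrebiworld.restrict _ _, fun β hβ => ?_⟩
    rw [entry_restrict]
    exact ih β hβ _
  | add_one α _ =>
    have h' : α ≤ μ := by simpa using h
    rw [isBiworld_succ]
    refine ⟨hw.isPrebiworld.restrict _ _, ?_⟩
    rw [isBiworld_succ] at hw
    intro A
    simp only [mem_poss_restrict w h', mem_imposs_restrict w h']
    obtain ⟨hu, hi⟩ := hw.2 A
    refine ⟨fun x => ⟨fun hx => ?_, ?_⟩, ?_⟩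
    · obtain ⟨z, hz, rfl⟩ := hX α h' x hx
      exact ((hu z).mp hz).imp (fun hz => ⟨z, hz, rfl⟩) fun hz => ⟨z, hz, rfl⟩
    · rintro (⟨y, hy, rfl⟩ | ⟨y, hy, rfl⟩)
      · exact hR _ _ _ ((hu y).mpr (Or.inl hy))
      · exact hR _ _ _ ((hu y).mpr (Or.inr hy))
    · rintro x ⟨y, hy, e⟩ ⟨y', hy', e'⟩
      have hyw := (hu y).mpr (Or.inl hy)
      have hyw' := (hu y').mpr (Or.inr hy')
      rcases h'.lt_or_eq with hlt | rfl
      -- Were `x` completed, its two lifts would be one completed biworld lying on both sides of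
      -- `w`, which is impossible.
      · by_contra hc
        have hx : IsBiworld x := e ▸ hR _ _ _ hyw
        obtain ⟨rfl, hyc⟩ := extension_unique hlt (hE α hlt) hR hx hc hyw hyw' e e'
        exact hyc (hi y hy hy')
      · rw [restrict_self hyw.isPrebiworld] at e
        rw [restrict_self hyw'.isPrebiworld] at e'
        subst e
        subst e'
        exact hi _ hy hy'

theorem ExtendsBiworlds.succ {μ : Ordinal.{0}} (hX : ExtendsBiworlds P Ag μ)
    (hE : HasDecidedExtensions P Ag μ) : ExtendsBiworlds P Ag (μ + 1) := by
  intro α h x hx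
  rcases h.lt_or_eq with h' | rfl
  · have h'' : α ≤ μ := Order.lt_add_one_iff.mp h'
    obtain ⟨z, hz, rfl⟩ := hX α h'' x hx
    obtain ⟨v, hv, _, rfl⟩ := hE z hz
    exact ⟨v, hv, (restrict_restrict hv.isPrebiworld _ _).symm⟩
  · exact ⟨x, hx, restrict_self hx.isPrebiworld⟩

/-- Disjointness makes the condition on overlaps vacuous. -/
theorem isBiworld_mkSucc {μ : Ordinal.{0}} {I : Set P} {C D : Ag → Set (Carrier P Ag μ)}
    (hu : ∀ A x, x ∈ {x : Carrier P Ag μ | IsBiworld x} ↔ x ∈ C A ∨ x ∈ D A)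
    (hd : ∀ A, ∀ x ∈ C A, x ∉ D A) :
    IsBiworld (mkSucc I C D) ∧ IsDecided (mkSucc I C D) := by
  rw [isBiworld_succ, isPrebiworld_succ, IsDecided]
  simp only [poss_mkSucc, imposs_mkSucc]
  exact ⟨⟨fun A => ⟨fun x hx => ((hu A x).mpr (Or.inl hx)).isPrebiworld,
    fun x hx => ((hu A x).mpr (Or.inr hx)).isPrebiworld⟩,
    fun A => ⟨hu A, fun x hx hx' => absurd hx' (hd A x hx)⟩⟩, hd⟩

theorem HasDecidedExtensions.succ {μ : Ordinal.{0}} (hR : RestrictsToBiworlds P Ag (μ + 1))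
    (hX : ExtendsBiworlds P Ag (μ + 1)) : HasDecidedExtensions P Ag (μ + 1) := by
  intro w hw
  have hw' := (isBiworld_succ.mp hw).2
  have key : ∀ A : Ag, _ := fun A => exists_split
    (r := fun y : Carrier P Ag (μ + 1) => restrict y μ le_self_add) (W := {y | IsBiworld y})
    (S := poss w A) (T := imposs w A)
    (fun y hy => ((hw' A).1 _).mp (hR _ _ _ hy))
    (fun x hx => hX _ _ _ (((hw' A).1 x).mpr (Or.inl hx)))
    (fun x hx => hX _ _ _ (((hw' A).1 x).mpr (Or.inr hx)))
    (fun x hx hx' => by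
      obtain ⟨_, v₁, v₂, h₁, h₂, hne, ⟨_, e₁⟩, ⟨_, e₂⟩⟩ :=
        isIncompleted_iff.mp ((hw' A).2 x hx hx')
      exact ⟨v₁, h₁, v₂, h₂, hne, e₁, e₂⟩)
  choose C D hu hd hC hD using key
  obtain ⟨hv, hvd⟩ := isBiworld_mkSucc (I := obj _ w) hu hd
  refine ⟨_, hv, hvd, ?_⟩
  rw [restrict_succ _ (le_self_add : μ ≤ μ + 1)]
  refine ext_succ (by simp) (fun A => ?_) fun A => ?_
  · ext x
    simp [hC]
  · ext x
    simp [hD]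

/-! ### Limit depths -/

instance nonempty_carrier (μ : Ordinal.{0}) : Nonempty (Carrier P Ag μ) := by
  induction μ using Ordinal.limitRecOn with
  | zero => exact ⟨(zeroEquiv P Ag).symm ∅⟩
  | add_one μ _ => exact ⟨mkSucc ∅ (fun _ => ∅) fun _ => ∅⟩
  | limit l hl ih => exact ⟨mkLimit hl fun β hβ => (ih β hβ).some⟩

/-- This is where countability enters: a countable limit has cofinality ω. -/
theorem exists_strictMono_cofinal {l : Ordinal.{0}} (hl : Order.IsSuccLimit l)
    (hc : l.card ≤ Cardinal.aleph0) {α : Ordinal.{0}} (hα : α < l) :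
    ∃ f : ℕ → Ordinal.{0}, StrictMono f ∧ f 0 = α ∧ (∀ n, f n < l) ∧ ∀ β < l, ∃ n, β ≤ f n := by
  have hcount : Countable (Set.Iio l) := by
    rw [← Cardinal.mk_le_aleph0_iff, Cardinal.mk_Iio_ordinal]
    rwa [Cardinal.lift_le_aleph0]
  have : Nonempty (Set.Iio l) := ⟨⟨α, hα⟩⟩
  obtain ⟨g, hg⟩ := exists_surjective_nat (Set.Iio l)
  let f : ℕ → Set.Iio l := fun n => Nat.rec ⟨α, hα⟩
    (fun n x => ⟨max x (g n) + 1, hl.add_one_lt (max_lt x.2 (g n).2)⟩) n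
  have hf : ∀ n, (f (n + 1) : Ordinal) = max (f n) (g n) + 1 := fun _ => rfl
  refine ⟨fun n => (f n).1, strictMono_nat_of_lt_succ fun n => ?_, rfl, fun n => (f n).2,
    fun β hβ => ?_⟩
  · rw [hf]
    exact Order.lt_add_one_iff.mpr (le_max_left _ _)
  · obtain ⟨n, hn⟩ := hg ⟨β, hβ⟩
    refine ⟨n + 1, ?_⟩
    change β ≤ (f (n + 1)).1
    rw [hf, hn]
    exact (le_max_right _ _).trans le_self_add

/-- A coherent sequence of biworlds of depths cofinal in `l` has a limit. -/
theorem exists_limit_biworld {l : Ordinal.{0}} (hl : Order.IsSuccLimit l)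
    (hR : ∀ β < l, RestrictsToBiworlds P Ag β) {f : ℕ → Ordinal.{0}} (hf : Monotone f)
    (hfl : ∀ n, f n < l) (hcof : ∀ β < l, ∃ n, β ≤ f n) (z : ∀ n, Carrier P Ag (f n))
    (hz : ∀ n, IsBiworld (z n))
    (hzz : ∀ n, restrict (z (n + 1)) (f n) (hf n.le_succ) = z n) :
    ∃ u : Carrier P Ag l, IsBiworld u ∧ ∀ n, restrict u (f n) (hfl n).le = z n := by
  have coh : ∀ {m n} (h : m ≤ n), restrict (z n) (f m) (hf h) = z m := by
    intro m n h
    induction n, h using Nat.le_induction with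
    | base => exact restrict_self (hz m).isPrebiworld
    | succ n h ih =>
      rw [← ih, ← hzz n, restrict_restrict (hz _).isPrebiworld]
  choose N hN using hcof
  -- Entry `β` of the limit is read off any term of depth at least `β`; coherence makes the choice
  -- immaterial.
  have indep : ∀ β (hβ : β < l) n (h : β ≤ f n),
      restrict (z (N β hβ)) β (hN β hβ) = restrict (z n) β h := by
    intro β hβ n h
    rcases le_total n (N β hβ) with h' | h'
    · rw [← coh h', restrict_restrict (hz _).isPrebiworld]
    · rw [← coh h', restrict_restrict (hz _).isPrebiworld]
  have hu : IsBiworld (mkLimit hl fun β hβ => restrict (z (N β hβ)) β (hN β hβ)) := by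
    rw [isBiworld_limit hl, isPrebiworld_limit hl]
    simp only [entry_mkLimit]
    refine ⟨⟨fun β hβ => (hz _).isPrebiworld.restrict _ _, fun γ β hγ hβ => ⟨hγ, ?_⟩⟩,
      fun β hβ => hR _ (hfl _) _ _ _ (hz _)⟩
    rw [restrict_restrict (hz _).isPrebiworld, indep]
  refine ⟨_, hu, fun n => ?_⟩
  rw [← entry_eq_restrict hl hu.isPrebiworld _ (hfl n), entry_mkLimit, indep _ _ n le_rfl,
    restrict_self (hz n).isPrebiworld]

theorem RestrictsToBiworlds.limit {l : Ordinal.{0}} (hl : Order.IsSuccLimit l) :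
    RestrictsToBiworlds P Ag l := by
  intro α h w hw
  rcases h.lt_or_eq with h' | rfl
  · rw [← entry_eq_restrict hl hw.isPrebiworld _ h']
    exact ((isBiworld_limit hl).mp hw).2 _ _
  · rwa [restrict_self hw.isPrebiworld]

/-- Extend repeatedly along a cofinal sequence starting at `α`, then glue. -/
theorem ExtendsBiworlds.limit {l : Ordinal.{0}} (hl : Order.IsSuccLimit l)
    (hc : l.card ≤ Cardinal.aleph0) (hR : ∀ β < l, RestrictsToBiworlds P Ag β)
    (hX : ∀ β < l, ExtendsBiworlds P Ag β) : ExtendsBiworlds P Ag l := by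
  intro α h x hx
  rcases h.lt_or_eq with h' | rfl
  swap
  · exact ⟨x, hx, restrict_self hx.isPrebiworld⟩
  obtain ⟨f, hf, rfl, hfl, hcof⟩ := exists_strictMono_cofinal hl hc h'
  have step : ∀ n (y : {y : Carrier P Ag (f n) // IsBiworld y}),
      ∃ z : {z : Carrier P Ag (f (n + 1)) // IsBiworld z},
        restrict z.1 (f n) (hf.monotone n.le_succ) = y.1 := by
    intro n y
    obtain ⟨z, hz, e⟩ := hX _ (hfl (n + 1)) (f n) (hf.monotone n.le_succ) y.1 y.2
    exact ⟨⟨z, hz⟩, e⟩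
  choose c hc using step
  let z : ∀ n, {y : Carrier P Ag (f n) // IsBiworld y} := fun n =>
    Nat.rec ⟨x, hx⟩ (fun n y => c n y) n
  obtain ⟨u, hu, hue⟩ := exists_limit_biworld hl hR hf.monotone hfl hcof (fun n => (z n).1)
    (fun n => (z n).2) fun n => hc n (z n)
  exact ⟨u, hu, hue 0⟩

theorem HasDecidedExtensions.limit {l : Ordinal.{0}} (hl : Order.IsSuccLimit l)
    (hc : l.card ≤ Cardinal.aleph0) (hR : ∀ β < l, RestrictsToBiworlds P Ag β)
    (hX : ∀ β < l, ExtendsBiworlds P Ag β) : HasDecidedExtensions P Ag l := by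
  intro w hw
  have hRl : RestrictsToBiworlds P Ag l := RestrictsToBiworlds.limit hl
  obtain ⟨f, hf, -, hfl, hcof⟩ := exists_strictMono_cofinal hl hc hl.bot_lt
  have hw' : ∀ β (h : β < l), _ := fun β h =>
    (isBiworld_succ.mp (hRl (β + 1) (hl.add_one_lt h).le w hw)).2
  have hle : ∀ n, f n ≤ f (n + 1) := fun n => hf.monotone n.le_succ
  have hposs : ∀ A {β γ} (h : β ≤ γ) (hγ : γ < l) (x : Carrier P Ag β),
      x ∈ poss (restrict w (β + 1) (hl.add_one_lt (h.trans_lt hγ)).le) A ↔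
        ∃ y ∈ poss (restrict w (γ + 1) (hl.add_one_lt hγ).le) A, restrict y β h = x := by
    intro A β γ h hγ x
    have h' : β + 1 ≤ γ + 1 := by simpa using h
    rw [← mem_poss_restrict _ h h', restrict_restrict hw.isPrebiworld]
  have himposs : ∀ A {β γ} (h : β ≤ γ) (hγ : γ < l) (x : Carrier P Ag β),
      x ∈ imposs (restrict w (β + 1) (hl.add_one_lt (h.trans_lt hγ)).le) A ↔
        ∃ y ∈ imposs (restrict w (γ + 1) (hl.add_one_lt hγ).le) A, restrict y β h = x := by
    intro A β γ h hγ x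
    have h' : β + 1 ≤ γ + 1 := by simpa using h
    rw [← mem_imposs_restrict _ h h', restrict_restrict hw.isPrebiworld]
  have key : ∀ A : Ag, _ := fun A => exists_split_of_inverse_limit
    (X := fun n => Carrier P Ag (f n)) (Y := Carrier P Ag l)
    (r := fun n y => restrict y (f n) (hle n))
    (p := fun n y => restrict y (f n) (hfl n).le) (W := {y | IsBiworld y})
    (V := fun n => {y | IsBiworld y})
    (S := fun n => poss (restrict w (f n + 1) (hl.add_one_lt (hfl n)).le) A)
    (T := fun n => imposs (restrict w (f n + 1) (hl.add_one_lt (hfl n)).le) A)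
    (fun n x => (hw' _ (hfl n) A).1 x)
    (fun n y hy => hRl _ _ y hy)
    (fun n y hy => restrict_restrict hy.isPrebiworld _ _)
    (fun n z hz hzz => exists_limit_biworld (f := fun k => f (n + k)) hl hR
      (fun a b h => hf.monotone (by simpa using h)) (fun k => hfl _)
      (fun β hβ => by
        obtain ⟨m, hm⟩ := hcof β hβ
        exact ⟨m, hm.trans (hf.monotone (Nat.le_add_left m n))⟩) z hz hzz)
    (fun n x hx => (hposs A (hle n) (hfl (n + 1)) _).mpr ⟨x, hx, rfl⟩)
    (fun n x hx => (himposs A (hle n) (hfl (n + 1)) _).mpr ⟨x, hx, rfl⟩)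
    (fun n x hx => (hposs A (hle n) (hfl (n + 1)) x).mp hx)
    (fun n x hx => (himposs A (hle n) (hfl (n + 1)) x).mp hx)
    (fun n x hx hx' => by
      obtain ⟨_, v₁, v₂, h₁, h₂, hne, ⟨_, e₁⟩, ⟨_, e₂⟩⟩ :=
        isIncompleted_iff.mp ((hw' _ (hfl n) A).2 x hx hx')
      -- Incompleteness gives two points only at depth `f n + 1`; they are lifted to depth `f (n +
      -- 1)`, where they stay distinct.
      have hn : f n + 1 ≤ f (n + 1) := Order.add_one_le_iff.mpr (hf n.lt_succ_self)
      obtain ⟨y₁, hy₁, rfl⟩ := hX _ (hfl (n + 1)) _ hn v₁ h₁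
      obtain ⟨y₂, hy₂, rfl⟩ := hX _ (hfl (n + 1)) _ hn v₂ h₂
      rw [restrict_restrict hy₁.isPrebiworld] at e₁
      rw [restrict_restrict hy₂.isPrebiworld] at e₂
      exact ⟨y₁, hy₁, y₂, hy₂, fun e => hne (by rw [e]), e₁, e₂⟩)
  choose C D hu hd hC hD using key
  obtain ⟨hv, hvd⟩ := isBiworld_mkSucc (I := obj _ w) hu hd
  have hCw : ∀ A, ∀ y ∈ C A, IsBiworld y := fun A y hy => (hu A y).mpr (Or.inl hy)
  have hDw : ∀ A, ∀ y ∈ D A, IsBiworld y := fun A y hy => (hu A y).mpr (Or.inr hy)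
  refine ⟨_, hv, hvd, ?_⟩
  refine ext_restrict_limit hl (hv.isPrebiworld.restrict _ _) hw.isPrebiworld fun β hβ => ?_
  have hβl : β < l := (Order.lt_add_one_iff.mpr le_rfl).trans hβ
  rw [restrict_restrict hv.isPrebiworld]
  -- The projections of `C` and `D` are known only at depths `f n`, so depth `β` is reached through
  -- a larger `f n`.
  obtain ⟨n, hn⟩ := hcof β hβl
  refine ext_succ ?_ (fun A => Set.ext fun x => ?_) fun A => Set.ext fun x => ?_
  · rw [obj_restrict hv.isPrebiworld, obj_mkSucc, obj_restrict hw.isPrebiworld]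
  · rw [mem_poss_restrict _ hβl.le, poss_mkSucc, hposs A hn (hfl n)]
    constructor
    · rintro ⟨y, hy, rfl⟩
      exact ⟨_, (hC A n _).mpr ⟨y, hy, rfl⟩, restrict_restrict (hCw A y hy).isPrebiworld _ _⟩
    · rintro ⟨y', hy', rfl⟩
      obtain ⟨y, hy, rfl⟩ := (hC A n _).mp hy'
      exact ⟨y, hy, (restrict_restrict (hCw A y hy).isPrebiworld _ _).symm⟩
  · rw [mem_imposs_restrict _ hβl.le, imposs_mkSucc, himposs A hn (hfl n)]
    constructor
    · rintro ⟨y, hy, rfl⟩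
      exact ⟨_, (hD A n _).mpr ⟨y, hy, rfl⟩, restrict_restrict (hDw A y hy).isPrebiworld _ _⟩
    · rintro ⟨y', hy', rfl⟩
      obtain ⟨y, hy, rfl⟩ := (hD A n _).mp hy'
      exact ⟨y, hy, (restrict_restrict (hDw A y hy).isPrebiworld _ _).symm⟩

/-! ### Countable depths -/

variable (P Ag) in
-- The three properties need each other: restriction to depths below a successor uses lifts and
-- decided extensions at smaller depths, lifting uses decided extensions, and splitting uses
-- restriction and lifting.
theorem biworld_extension_properties (μ : Ordinal.{0}) (hμ : μ.card ≤ Cardinal.aleph0) :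
    RestrictsToBiworlds P Ag μ ∧ ExtendsBiworlds P Ag μ ∧ HasDecidedExtensions P Ag μ := by
  induction μ using WellFoundedLT.induction with
  | ind μ ih =>
  have ih' := fun β (hβ : β < μ) => ih β hβ ((Ordinal.card_le_card hβ.le).trans hμ)
  clear ih
  rcases Ordinal.zero_or_succ_or_isSuccLimit μ with rfl | ⟨ν, rfl⟩ | hl
  · refine ⟨fun α h w _ => ?_, fun α h x hx => ?_, HasDecidedExtensions.zero⟩
    · obtain rfl : α = 0 := by simpa using h
      exact isBiworld_zero _
    · obtain rfl : α = 0 := by simpa using h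
      exact ⟨x, hx, restrict_self hx.isPrebiworld⟩
  · have hν := ih' ν (Order.lt_add_one_iff.mpr le_rfl)
    have hR := hν.1.succ hν.2.1 fun α hα => (ih' α (hα.trans (Order.lt_add_one_iff.mpr le_rfl))).2.2
    have hX := hν.2.1.succ hν.2.2
    exact ⟨hR, hX, HasDecidedExtensions.succ hR hX⟩
  · have hR := fun β hβ => (ih' β hβ).1
    have hX := fun β hβ => (ih' β hβ).2.1
    exact ⟨.limit hl, .limit hl hμ hR hX, .limit hl hμ hR hX⟩

end EpistemicBiworld

theorem corollary1 {P : Type u} {Ag : Type v} (μ : Ordinal.{0})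
    (hμ : μ.card ≤ Cardinal.aleph0)
    (w : EpistemicBiworld.Carrier P Ag μ) (hw : EpistemicBiworld.IsBiworld w) :
    (EpistemicBiworld.IsCompleted w ↔
      ∃! v : EpistemicBiworld.Carrier P Ag (μ + 1),
        EpistemicBiworld.IsBiworld v ∧ EpistemicBiworld.LessPrecise w v) ∧
    (EpistemicBiworld.IsCompleted w →
      ∀ v : EpistemicBiworld.Carrier P Ag (μ + 1),
        EpistemicBiworld.IsBiworld v → EpistemicBiworld.LessPrecise w v →
          EpistemicBiworld.IsCompleted v) := by
  have hE := (EpistemicBiworld.biworld_extension_properties P Ag μ hμ).2.2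
  refine ⟨⟨fun hc => ?_, ?_⟩, fun hc v hv e => ⟨hv.isPrebiworld, ?_⟩⟩
  · obtain ⟨v, hv, -, e⟩ := hE w hw
    exact ⟨v, ⟨hv, _, e⟩, fun v' hv' =>
      EpistemicBiworld.eq_of_not_isIncompleted hc.1 hc.2 hv'.1 hv hv'.2 ⟨_, e⟩⟩
  · rintro ⟨v, -, huniq⟩
    refine ⟨hw.isPrebiworld, fun hi => ?_⟩
    obtain ⟨-, v₁, v₂, h₁, h₂, hne, e₁, e₂⟩ := EpistemicBiworld.isIncompleted_iff.mp hi
    exact hne ((huniq v₁ ⟨h₁, e₁⟩).trans (huniq v₂ ⟨h₂, e₂⟩).symm)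
  · have hd := hE.isDecided hw hc.2 hv e
    -- Viewing `v` as its own restriction puts it in the form where decided implies completed.
    rw [← EpistemicBiworld.restrict_self hv.isPrebiworld] at hd
    exact hd.not_isIncompleted le_rfl
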